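/- Let $X$ be an orientable surface, i.e. a connected, Hausdorff, second countable topological $2$-manifold without boundary that contains no Möbius band. An end of $X$ is represented by a nested sequence $U_0\supset U_1\supset\cdots$ of connected open subsurfaces with compact frontier and $\bigcap_i\overline{U_i}=\emptyset$; two such sequences represent the same end if every member of either one contains a member of the other. An arc of $X$ is a proper embedding $\alpha:\mathbb R\to X$ such that $\alpha(t)$ converges to an end of $X$ as $t\to+\infty$ and to an end of $X$ as $t\to-\infty$, where converging to the end $\{U_i\}$ means eventually lying in each $U_i$; the arc joins these two ends. An ideal triangulation of $X$ is a countable collection $\mu$ of pairwise disjoint arcs such that each component of $X\setminus\bigcup\mu$ is an open disk bounded by at most three sides of arcs of $\mu$, and each of the two sides of every arc of $\mu$ is a side of one of these disks (possibly both sides of the same disk). Let $\mu$ be an ideal triangulation of $X$ and let $e\neq f$ be ends of $X$. Then only finitely many arcs of $\mu$ join $e$ and $f$. -/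

import Mathlib

open Set Filter Topology

/-- `X` contains an (open) Möbius band: there is an open embedding into `X` of the quotient of the
plane by the group generated by `(x, y) ↦ (x + 1, -y)`, i.e. a continuous open map from the plane to
`X` whose fibres are exactly the orbits of that group. -/
def ContainsMoebiusBand (X : Type*) [TopologicalSpace X] : Prop :=
  ∃ f : ℝ × ℝ → X, Continuous f ∧ IsOpenMap f ∧
    ∀ p q : ℝ × ℝ, f p = f q ↔ ∃ n : ℤ, q = (p.1 + n, (-1 : ℝ) ^ n * p.2)

/-- A surface is orientable if it contains no Möbius band. -/
def OrientableSurface (X : Type*) [TopologicalSpace X] : Prop :=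
  ¬ ContainsMoebiusBand X

/-- A nested sequence of connected open subsurfaces with compact frontier which leaves every
compact set. Such sequences represent the ends of `X`. -/
structure EndSequence (X : Type*) [TopologicalSpace X] where
  U : ℕ → Set X
  isOpen_U : ∀ i, IsOpen (U i)
  isConnected_U : ∀ i, IsConnected (U i)
  isCompact_frontier : ∀ i, IsCompact (frontier (U i))
  nested : ∀ i, U (i + 1) ⊆ U i
  iInter_closure : ⋂ i, closure (U i) = ∅

/-- Two sequences are equivalent if each member of either of them contains a member of the
other. -/
instance endSetoid (X : Type*) [TopologicalSpace X] : Setoid (EndSequence X) where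
  r s t := (∀ i, ∃ j, t.U j ⊆ s.U i) ∧ (∀ j, ∃ i, s.U i ⊆ t.U j)
  iseqv :=
    { refl := fun _ => ⟨fun i => ⟨i, Subset.rfl⟩, fun i => ⟨i, Subset.rfl⟩⟩
      symm := fun h => ⟨h.2, h.1⟩
      trans := fun {s t u} h k => by
        constructor
        · intro i
          obtain ⟨j, hj⟩ := h.1 i
          obtain ⟨l, hl⟩ := k.1 j
          exact ⟨l, hl.trans hj⟩
        · intro l
          obtain ⟨j, hj⟩ := k.2 l
          obtain ⟨i, hi⟩ := h.2 j
          exact ⟨i, hi.trans hj⟩ }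

/-- The ends of `X`. -/
def SurfaceEnd (X : Type*) [TopologicalSpace X] : Type _ :=
  Quotient (endSetoid X)

/-- The map `α` converges to the end `e` along the filter `l` (which is `atTop` or `atBot`). -/
def TendsToEnd {X : Type*} [TopologicalSpace X] (α : ℝ → X) (l : Filter ℝ) (e : SurfaceEnd X) :
    Prop :=
  ∃ s : EndSequence X, (Quotient.mk (endSetoid X) s : SurfaceEnd X) = e ∧
    ∀ i, ∀ᶠ t in l, α t ∈ s.U i

/-- An arc of `X`: a proper embedding of the real line, each of whose two ends converges to an
end of `X`. -/
structure Arc (X : Type*) [TopologicalSpace X] where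
  toFun : ℝ → X
  isEmbedding : IsEmbedding toFun
  isProperMap : IsProperMap toFun
  exists_end_atBot : ∃ e : SurfaceEnd X, TendsToEnd toFun atBot e
  exists_end_atTop : ∃ e : SurfaceEnd X, TendsToEnd toFun atTop e

namespace Arc

variable {X : Type*} [TopologicalSpace X]

/-- The set of points of an arc. -/
def image (a : Arc X) : Set X :=
  range a.toFun

/-- The arc `a` joins the ends `e` and `f`, in one of the two directions. -/
def Joins (a : Arc X) (e f : SurfaceEnd X) : Prop :=
  (TendsToEnd a.toFun atBot e ∧ TendsToEnd a.toFun atTop f) ∨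
    (TendsToEnd a.toFun atBot f ∧ TendsToEnd a.toFun atTop e)

/-- A two-sided collar (tubular neighbourhood) of an arc. -/
structure Collar (a : Arc X) where
  map : ℝ × ℝ → X
  isOpenEmbedding : IsOpenEmbedding map
  map_zero : ∀ t, map (t, 0) = a.toFun t

/-- The upper side of an arc with respect to a collar, as a germ along the arc: a set belongs to
this filter iff it contains all points of the upper half of the collar which are close enough to
the arc. -/
def Collar.upper {a : Arc X} (c : Collar a) : Filter X :=
  Filter.map c.map (𝓝ˢ {p : ℝ × ℝ | p.2 = 0} ⊓ 𝓟 {p : ℝ × ℝ | 0 < p.2})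

/-- The lower side of an arc with respect to a collar. -/
def Collar.lower {a : Arc X} (c : Collar a) : Filter X :=
  Filter.map c.map (𝓝ˢ {p : ℝ × ℝ | p.2 = 0} ⊓ 𝓟 {p : ℝ × ℝ | p.2 < 0})

/-- `F` is one of the sides of the arc `a`. Different collars yield the same two germs, so an arc
has two sides in this sense. -/
def IsSide (a : Arc X) (F : Filter X) : Prop :=
  ∃ c : Collar a, F = c.upper ∨ F = c.lower

end Arc

section Triangulation

variable {X : Type*} [TopologicalSpace X]

/-- An open disk in `X`: an open subset homeomorphic to the open unit disk of the Euclidean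
plane. -/
def IsOpenDisk (D : Set X) : Prop :=
  IsOpen D ∧ Nonempty (D ≃ₜ Metric.ball (0 : EuclideanSpace ℝ (Fin 2)) 1)

/-- The union of the arcs of a collection of arcs. -/
def arcUnion (T : Set (Arc X)) : Set X :=
  ⋃ a ∈ T, a.image

/-- `C` is a connected component of the complement of the arcs of `T`. -/
def IsComplementaryComponent (T : Set (Arc X)) (C : Set X) : Prop :=
  ∃ x ∈ (arcUnion T)ᶜ, C = connectedComponentIn (arcUnion T)ᶜ x

/-- The set of those sides of arcs of `T` which are adjacent to `C`. -/
def adjacentSides (T : Set (Arc X)) (C : Set X) : Set (Filter X) :=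
  {F | (∃ a ∈ T, a.IsSide F) ∧ C ∈ F}

/-- `C` is bounded by at most three sides of arcs of `T`: at most three sides are adjacent to
`C`, and the frontier of `C` lies on the arcs to which these sides belong. -/
def BoundedByAtMostThreeSides (T : Set (Arc X)) (C : Set X) : Prop :=
  (adjacentSides T C).encard ≤ 3 ∧
    frontier C ⊆ ⋃ a ∈ {a ∈ T | ∃ F, a.IsSide F ∧ C ∈ F}, a.image

/-- An ideal triangulation of `X`: a countable collection of pairwise disjoint arcs such that
every component of the complement is an open disk bounded by at most three sides of arcs, and
each of the two sides of every arc is a side of one of these disks (the two disks may coincide). -/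
structure IsIdealTriangulation (T : Set (Arc X)) : Prop where
  countable : T.Countable
  disjoint : ∀ a ∈ T, ∀ b ∈ T, a ≠ b → Disjoint a.image b.image
  isOpenDisk : ∀ C, IsComplementaryComponent T C → IsOpenDisk C
  atMostThreeSides : ∀ C, IsComplementaryComponent T C → BoundedByAtMostThreeSides T C
  twoSides : ∀ a ∈ T, ∃ c : a.Collar,
    (∃ C, IsComplementaryComponent T C ∧ C ∈ c.upper) ∧
      (∃ C, IsComplementaryComponent T C ∧ C ∈ c.lower)

end Triangulation

/-!
The arcs of an ideal triangulation form a locally finite family, and distinct ends are separated by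
a compact set; the theorem follows, since a compact set meets only finitely many members of a
locally finite family.

Local finiteness (`IsIdealTriangulation.locallyFinite_image`) comes from the disks. A point off the
arcs has the complementary disk containing it as a neighbourhood, and this meets no arc. A point on
an arc `a` has a neighbourhood, cut out of a collar of `a`, that consists of points of `a` and of
the two disks on either side of `a`, hence meets no arc but `a`.

For the separation (`exists_isCompact_inter_nonempty`), let the sequences `U` and `V` represent
distinct ends, so that, up to exchanging them, some `U i` contains no `V j`. The compact frontier of
`U i` misses some `V j`, which is connected and hence disjoint from `U i`. An arc joining the two
ends has points in `U i` and in `V j`, so it crosses the frontier of `U i`.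
-/

/-- Convergence to an end can be tested on any sequence representing the end. -/
theorem TendsToEnd.eventually_mem {X : Type*} [TopologicalSpace X] {α : ℝ → X} {l : Filter ℝ}
    {s : EndSequence X} (h : TendsToEnd α l (Quotient.mk (endSetoid X) s)) (i : ℕ) :
    ∀ᶠ t in l, α t ∈ s.U i := by
  obtain ⟨s', hs', h⟩ := h
  obtain ⟨j, hj⟩ := (Quotient.exact hs').2 i
  exact (h j).mono fun _ ht => hj ht

theorem Arc.Joins.symm {X : Type*} [TopologicalSpace X] {a : Arc X} {e f : SurfaceEnd X}
    (h : a.Joins e f) : a.Joins f e :=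
  Or.symm h

theorem Arc.Joins.exists_mem {X : Type*} [TopologicalSpace X] {a : Arc X} {s t : EndSequence X}
    (h : a.Joins (Quotient.mk (endSetoid X) s) (Quotient.mk (endSetoid X) t)) (i j : ℕ) :
    (a.image ∩ s.U i).Nonempty ∧ (a.image ∩ t.U j).Nonempty := by
  rcases h with ⟨hs, ht⟩ | ⟨ht, hs⟩ <;>
  · obtain ⟨x, hx⟩ := (hs.eventually_mem i).exists
    obtain ⟨y, hy⟩ := (ht.eventually_mem j).exists
    exact ⟨⟨_, mem_range_self x, hx⟩, ⟨_, mem_range_self y, hy⟩⟩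

namespace EndSequence

variable {X : Type*} [TopologicalSpace X]

theorem antitone (s : EndSequence X) : Antitone s.U :=
  antitone_nat_of_succ_le s.nested

theorem exists_disjoint_of_isCompact (s : EndSequence X) {K : Set X} (hK : IsCompact K) :
    ∃ j, Disjoint K (s.U j) := by
  obtain ⟨j, hj⟩ := hK.elim_directed_family_closed (fun j => closure (s.U j))
    (fun _ => isClosed_closure) (by rw [s.iInter_closure, inter_empty])
    (directed_of_isDirected_le fun _ _ h => closure_mono (s.antitone h))
  exact ⟨j, (disjoint_iff_inter_eq_empty.2 hj).mono_right subset_closure⟩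

end EndSequence

/-- A connected set with a point inside and a point outside `U` meets the frontier of `U`. -/
theorem IsPreconnected.inter_frontier_nonempty_of_inter {X : Type*} [TopologicalSpace X]
    {A U : Set X} (hA : IsPreconnected A) (h : (A ∩ U).Nonempty) (h' : (A ∩ Uᶜ).Nonempty) :
    (A ∩ frontier U).Nonempty := by
  by_contra hne
  rw [not_nonempty_iff_eq_empty, ← disjoint_iff_inter_eq_empty, disjoint_left] at hne
  obtain ⟨x, hxA, hxU⟩ := h
  obtain ⟨y, hyA, hyU⟩ := h'
  obtain ⟨z, -, hz, hz'⟩ := hA (interior U) (closure U)ᶜ isOpen_interior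
    isClosed_closure.isOpen_compl
    (fun z hz => by
      by_contra hn
      rw [mem_union, mem_compl_iff, not_or, not_not] at hn
      exact hne hz ⟨hn.2, hn.1⟩)
    ⟨x, hxA, by_contra fun hn => hne hxA ⟨subset_closure hxU, hn⟩⟩
    ⟨y, hyA, fun hc => hne hyA ⟨hc, fun hi => hyU (interior_subset hi)⟩⟩
  exact hz' (subset_closure (interior_subset hz))

/-- If a member of `s` contains no member of `t`, its frontier is crossed by every arc joining the
ends that `s` and `t` represent. -/
theorem EndSequence.inter_frontier_nonempty {X : Type*} [TopologicalSpace X]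
    {s t : EndSequence X} {i : ℕ} (hi : ∀ j, ¬ t.U j ⊆ s.U i) {a : Arc X}
    (ha : a.Joins (Quotient.mk (endSetoid X) s) (Quotient.mk (endSetoid X) t)) :
    (a.image ∩ frontier (s.U i)).Nonempty := by
  obtain ⟨j, hj⟩ := t.exists_disjoint_of_isCompact (s.isCompact_frontier i)
  have hdisj : t.U j ∩ s.U i = ∅ := by
    by_contra hne
    obtain ⟨x, hx, hx'⟩ := (t.isConnected_U j).isPreconnected.inter_frontier_nonempty_of_inter
      (nonempty_iff_ne_empty.2 hne) (by simpa [inter_compl_nonempty_iff] using hi j)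
    exact disjoint_left.1 hj hx' hx
  obtain ⟨hs, x, hx, hxt⟩ := ha.exists_mem i j
  have hconn : IsPreconnected a.image := isPreconnected_range a.isEmbedding.continuous
  exact hconn.inter_frontier_nonempty_of_inter hs
    ⟨x, hx, fun hxs => (eq_empty_iff_forall_notMem.1 hdisj x) ⟨hxt, hxs⟩⟩

/-- Distinct ends are separated by a compact set. -/
theorem exists_isCompact_inter_nonempty {X : Type*} [TopologicalSpace X] {e f : SurfaceEnd X}
    (hef : e ≠ f) :
    ∃ K : Set X, IsCompact K ∧ ∀ a : Arc X, a.Joins e f → (a.image ∩ K).Nonempty := by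
  induction e using Quotient.inductionOn with | _ s
  induction f using Quotient.inductionOn with | _ t
  have hst : ¬ ((∀ i, ∃ j, t.U j ⊆ s.U i) ∧ (∀ j, ∃ i, s.U i ⊆ t.U j)) :=
    fun h => hef (Quotient.sound h)
  rw [not_and_or] at hst
  push Not at hst
  rcases hst with ⟨i, hi⟩ | ⟨j, hj⟩
  · exact ⟨_, s.isCompact_frontier i, fun a ha => EndSequence.inter_frontier_nonempty hi ha⟩
  · exact ⟨_, t.isCompact_frontier j, fun a ha => EndSequence.inter_frontier_nonempty hj ha.symm⟩

theorem IsComplementaryComponent.disjoint_image {X : Type*} [TopologicalSpace X] {T : Set (Arc X)}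
    {C : Set X} (hC : IsComplementaryComponent T C) {a : Arc X} (ha : a ∈ T) :
    Disjoint C a.image := by
  obtain ⟨x, -, rfl⟩ := hC
  exact disjoint_left.2 fun y hy hya =>
    connectedComponentIn_subset _ _ hy (mem_biUnion ha hya)

/-- If two sets belong to the two sides of an arc given by a collar, then together with the arc they
form a neighbourhood of the arc. -/
theorem Arc.Collar.union_mem_nhds {X : Type*} [TopologicalSpace X] {a : Arc X} (c : a.Collar)
    {C D : Set X} (hC : C ∈ c.upper) (hD : D ∈ c.lower) {x : X} (hx : x ∈ a.image) :
    C ∪ a.image ∪ D ∈ 𝓝 x := by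
  obtain ⟨t, rfl⟩ := hx
  rw [← c.map_zero, ← c.isOpenEmbedding.map_nhds_eq, Filter.mem_map]
  have hle : 𝓝 (t, (0 : ℝ)) ≤ 𝓝ˢ {p : ℝ × ℝ | p.2 = 0} := nhds_le_nhdsSet rfl
  have hC' := hle (mem_inf_principal.1 (Filter.mem_map.1 hC))
  have hD' := hle (mem_inf_principal.1 (Filter.mem_map.1 hD))
  filter_upwards [hC', hD'] with p hp hp'
  rcases lt_trichotomy p.2 0 with h | h | h
  · exact Or.inr (hp' h)
  · refine Or.inl (Or.inr ⟨p.1, ?_⟩)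
    rw [← c.map_zero, ← h]
  · exact Or.inl (Or.inl (hp h))

theorem IsIdealTriangulation.locallyFinite_image {X : Type*} [TopologicalSpace X]
    {T : Set (Arc X)} (hT : IsIdealTriangulation T) : LocallyFinite fun a : T => a.1.image := by
  intro x
  by_cases hx : x ∈ arcUnion T
  · obtain ⟨a, ha, hxa⟩ := mem_iUnion₂.1 hx
    obtain ⟨c, ⟨C, hC, hCc⟩, D, hD, hDc⟩ := hT.twoSides a ha
    refine ⟨_, c.union_mem_nhds hCc hDc hxa, (finite_singleton (⟨a, ha⟩ : T)).subset ?_⟩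
    rintro b ⟨y, hyb, (hy | hy) | hy⟩
    · exact (disjoint_left.1 (hC.disjoint_image b.2) hy hyb).elim
    · by_contra hne
      exact disjoint_left.1 (hT.disjoint a ha b b.2 fun h => hne (Subtype.ext h.symm)) hy hyb
    · exact (disjoint_left.1 (hD.disjoint_image b.2) hy hyb).elim
  · have hC : IsComplementaryComponent T (connectedComponentIn (arcUnion T)ᶜ x) := ⟨x, hx, rfl⟩
    refine ⟨_, (hT.isOpenDisk _ hC).1.mem_nhds (mem_connectedComponentIn hx),
      finite_empty.subset ?_⟩
    rintro b ⟨y, hyb, hy⟩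
    exact disjoint_left.1 (hC.disjoint_image b.2) hy hyb

theorem corollary3 {X : Type*} [TopologicalSpace X] [T2Space X] [SecondCountableTopology X]
    [ConnectedSpace X] [ChartedSpace (EuclideanSpace ℝ (Fin 2)) X]
    (hX : OrientableSurface X) (T : Set (Arc X)) (hT : IsIdealTriangulation T)
    (e f : SurfaceEnd X) (hef : e ≠ f) :
    {a ∈ T | a.Joins e f}.Finite := by
  obtain ⟨K, hK, h⟩ := exists_isCompact_inter_nonempty hef
  refine ((hT.locallyFinite_image.finite_nonempty_inter_compact hK).image Subtype.val).subset ?_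
  rintro a ⟨ha, hj⟩
  exact ⟨⟨a, ha⟩, h a hj, rfl⟩
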